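/- A *partial spread* of a $2n$-dimensional vector space is a set of $n$-dimensional subspaces any two of which meet only in $0$. In a symplectic (respectively orthogonal) space it is a *symplectic* (respectively *orthogonal*) partial spread if its members are totally isotropic (respectively totally singular); an orthogonal partial spread is an *orthogonal spread* if every singular vector lies in one of its members. "Maximal" means maximal with respect to inclusion among the partial spreads of the named kind. An $\mathrm{Sp}(2n,q)$-space is a $2n$-dimensional $\mathbb F_q$-space with a nondegenerate alternating bilinear form; an $\mathrm O^+(2n,q)$-space is a $2n$-dimensional $\mathbb F_q$-space with a quadratic form whose polar form is nondegenerate and which has a totally singular $n$-dimensional subspace. **Theorem.** Let $q$ be a power of $2$, and let $k\ge 1$ and $m$ be integers with $m>(k+1)/2$. (a) Every $\mathrm{Sp}(4mk-2,q)$-space has a maximal symplectic partial spread of size $q^{2mk-k}+1$. (b) Such partial spreads are obtained by projection, as follows. Let $(V,Q)$ be an $\mathrm O^+(4m,q^k)$-space, let $T\colon\mathbb F_{q^k}\to\mathbb F_q$ be the trace map, and let $Q'(v)=T(Q(v))$. Then $(V,Q)$ has an orthogonal spread, and $(V,Q')$ is an $\mathrm O^+(4mk,q)$-space. If $\Sigma$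 is any orthogonal spread of $(V,Q)$ then, over $\mathbb F_q$, $\Sigma$ is an orthogonal partial spread of $(V,Q')$ that is maximal among all partial spreads of the $\mathbb F_q$-space $V$, and $|\Sigma|=q^{2mk-k}+1$. Moreover, for every nonsingular point $z$ of $(V,Q')$ (a $1$-dimensional $\mathbb F_q$-subspace on which $Q'$ is not zero), the quotient $z^\perp/z$, with $\perp$ and the induced form taken with respect to the polar form of $Q'$, is an $\mathrm{Sp}(4mk-2,q)$-space, and $$\Sigma/z=\{\langle z^\perp\cap X,\,z\rangle/z \;:\; X\in\Sigma\}$$ is a maximal symplectic partial spread of $z^\perp/z$ of size $q^{2mk-k}+1$. -/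

import Mathlib

namespace PartialSpread

open Module

section Forms

variable {K V : Type*} [Field K] [AddCommGroup V] [Module K V]

/-- A subspace is totally isotropic for a bilinear form `B` if `B` vanishes on it. -/
def IsTotallyIsotropic (B : LinearMap.BilinForm K V) (X : Submodule K V) : Prop :=
  ∀ x ∈ X, ∀ y ∈ X, B x y = 0

/-- A subspace is totally singular for a quadratic form `Q` if `Q` vanishes on it. -/
def IsTotallySingular (Q : QuadraticForm K V) (X : Submodule K V) : Prop :=
  ∀ x ∈ X, Q x = 0

/-- `(V, B)` is a symplectic space of dimension `d`: `B` is a nondegenerate alternating form. -/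
structure IsSymplecticSpace (B : LinearMap.BilinForm K V) (d : ℕ) : Prop where
  finite : Module.Finite K V
  finrank_eq : finrank K V = d
  isAlt : B.IsAlt
  nondegenerate : B.Nondegenerate

/-- `(V, Q)` is an orthogonal space of plus type and dimension `2 n`: the polar form of `Q` is
nondegenerate and there is a totally singular subspace of dimension `n` (Witt index `n`). -/
structure IsOrthogonalPlusSpace (Q : QuadraticForm K V) (n : ℕ) : Prop where
  finite : Module.Finite K V
  finrank_eq : finrank K V = 2 * n
  nondegenerate : Q.polarBilin.Nondegenerate
  exists_singular : ∃ U : Submodule K V, IsTotallySingular Q U ∧ finrank K U = n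

end Forms

section Spreads

variable (K V : Type*) [Field K] [AddCommGroup V] [Module K V]

/-- A partial spread of a `2 n`-dimensional space `V`: a set of `n`-dimensional subspaces,
any two of which meet only in `0`. -/
structure IsPartialSpread (S : Set (Submodule K V)) : Prop where
  half_dim : ∀ X ∈ S, 2 * finrank K X = finrank K V
  inf_eq_bot : ∀ X ∈ S, ∀ Y ∈ S, X ≠ Y → X ⊓ Y = ⊥

variable {K V}

/-- A partial spread consisting of totally isotropic subspaces. -/
def IsSymplecticPartialSpread (B : LinearMap.BilinForm K V) (S : Set (Submodule K V)) : Prop :=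
  IsPartialSpread K V S ∧ ∀ X ∈ S, IsTotallyIsotropic B X

/-- A partial spread consisting of totally singular subspaces. -/
def IsOrthogonalPartialSpread (Q : QuadraticForm K V) (S : Set (Submodule K V)) : Prop :=
  IsPartialSpread K V S ∧ ∀ X ∈ S, IsTotallySingular Q X

/-- An orthogonal partial spread whose members cover all singular vectors. -/
def IsOrthogonalSpread (Q : QuadraticForm K V) (S : Set (Submodule K V)) : Prop :=
  IsOrthogonalPartialSpread Q S ∧ ∀ v : V, Q v = 0 → ∃ X ∈ S, v ∈ X

end Spreads

section Projection

variable {K V : Type*} [Field K] [AddCommGroup V] [Module K V]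

/-- The hyperplane `z^⊥` of all vectors perpendicular to `z` for the polar form of `Q`. -/
def perp (Q : QuadraticForm K V) (z : V) : Submodule K V :=
  LinearMap.ker (Q.polarBilin z)

/-- The line spanned by `z`, as a subspace of `z^⊥` (in characteristic two, `z ∈ z^⊥`). -/
def lineInPerp (Q : QuadraticForm K V) (z : V) : Submodule K (perp Q z) :=
  (Submodule.span K {z}).comap (perp Q z).subtype

/-- The quotient space `z^⊥ / z`. -/
abbrev PerpQuotient (Q : QuadraticForm K V) (z : V) : Type _ :=
  perp Q z ⧸ lineInPerp Q z

/-- The restriction to `z^⊥` of the polar form of `Q`. -/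
def perpForm (Q : QuadraticForm K V) (z : V) : LinearMap.BilinForm K (perp Q z) :=
  Q.polarBilin.domRestrict₁₂ (perp Q z) (perp Q z)

theorem perpForm_line (Q : QuadraticForm K V) (z : V) (x y : perp Q z)
    (hx : x ∈ lineInPerp Q z) : perpForm Q z x y = 0 := by
  obtain ⟨c, hc⟩ := Submodule.mem_span_singleton.mp hx
  have hy : Q.polarBilin z y = 0 := y.2
  change Q.polarBilin (x : V) (y : V) = 0
  have hc' : c • z = (x : V) := hc
  rw [← hc', map_smul, LinearMap.smul_apply, hy, smul_zero]

theorem perpForm_symm (Q : QuadraticForm K V) (z : V) (x y : perp Q z) :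
    perpForm Q z x y = perpForm Q z y x :=
  QuadraticMap.polar_comm Q x y

/-- The bilinear form induced on `z^⊥ / z` by the polar form of `Q`. -/
def quotientForm (Q : QuadraticForm K V) (z : V) :
    LinearMap.BilinForm K (PerpQuotient Q z) :=
  (lineInPerp Q z).liftQ
    ((lineInPerp Q z).liftQ (perpForm Q z)
      (fun x hx => LinearMap.ext fun y => perpForm_line Q z x y hx)).flip
    (fun x hx => LinearMap.ext fun w => by
      obtain ⟨y, rfl⟩ := (lineInPerp Q z).mkQ_surjective w
      exact (perpForm_symm Q z y x).trans (perpForm_line Q z x y hx))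

theorem quotientForm_mk (Q : QuadraticForm K V) (z : V) (x y : perp Q z) :
    quotientForm Q z ((lineInPerp Q z).mkQ x) ((lineInPerp Q z).mkQ y)
      = QuadraticMap.polar Q (x : V) (y : V) :=
  perpForm_symm Q z y x

/-- The projection `⟨z^⊥ ∩ X, z⟩ / z` of a subspace `X` into `z^⊥ / z`. -/
def projectSubspace (Q : QuadraticForm K V) (z : V) (X : Submodule K V) :
    Submodule K (PerpQuotient Q z) :=
  (((perp Q z ⊓ X) ⊔ Submodule.span K {z}).comap (perp Q z).subtype).map (lineInPerp Q z).mkQ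

end Projection

section Trace

variable (E : Type*) {F V : Type*} [Field E] [Field F] [Algebra E F]
  [AddCommGroup V] [Module F V] [Module E V] [IsScalarTower E F V]

/-- The quadratic form `v ↦ Tr(Q(v))` over the subfield `E`, with `Tr` the trace of `F / E`. -/
noncomputable def traceForm (Q : QuadraticForm F V) : QuadraticForm E V :=
  (Algebra.trace E F).compQuadraticMap' Q

theorem traceForm_apply (Q : QuadraticForm F V) (v : V) :
    traceForm E Q v = Algebra.trace E F (Q v) := rfl

/-- A set of `F`-subspaces of `V`, viewed as a set of `E`-subspaces. -/
def restrictSpread (S : Set (Submodule F V)) : Set (Submodule E V) :=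
  (fun X => X.restrictScalars E) '' S

end Trace

end PartialSpread

/-!
An `F`-quadratic form on `V` is a system of `[F : E] = k` quadratic forms over `E`, so by
Chevalley–Warning every `E`-subspace of `V` of dimension greater than `2k` contains a nonzero zero
of `Q`, which lies in some member of the spread. Hence every half-dimensional `E`-subspace of `V`
meets a member, and the spread is maximal over `E`.

In `z^⊥ / z` every coset of `z` in `z^⊥` contains exactly one singular vector, because
`Q' (v + c z) = Q' v + c² Q' z` and squaring is bijective on a perfect field of characteristic two.
Totally isotropic subspaces of `z^⊥ / z` therefore lift to totally singular subspaces of `V` of the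
same dimension. The lifts of half-dimensional ones have dimension `2mk - 1 > 2k`, so they again meet
a member, and the projected spread is maximal.

The size of a spread is found by counting the singular vectors in a coset `v + X₀`, where `X₀` is a
member and `v ∉ X₀`: every other member contains exactly one vector of the coset. Orthogonal spreads
exist by Kantor's Kerdock set of alternating forms, any two of which differ by a nonsingular form.
-/

namespace PartialSpread

open Module

section Isotropic

variable {K V : Type*} [Field K] [AddCommGroup V] [Module K V] {B : LinearMap.BilinForm K V}
  {U X : Submodule K V}

theorem IsTotallySingular.isTotallyIsotropic {Q : QuadraticForm K V}
    (hX : IsTotallySingular Q X) : IsTotallyIsotropic Q.polarBilin X := fun x hx y hy => by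
  simp [QuadraticMap.polar, hX _ (X.add_mem hx hy), hX _ hx, hX _ hy]

theorem IsTotallySingular.mono {Q : QuadraticForm K V} (hX : IsTotallySingular Q X)
    (hUX : U ≤ X) : IsTotallySingular Q U :=
  fun x hx => hX x (hUX hx)

theorem isTotallyIsotropic_bot (B : LinearMap.BilinForm K V) :
    IsTotallyIsotropic B (⊥ : Submodule K V) := fun x hx y _ => by
  rw [(Submodule.mem_bot K).mp hx, map_zero, LinearMap.zero_apply]

theorem IsTotallyIsotropic.le_orthogonal (hX : IsTotallyIsotropic B X) : X ≤ B.orthogonal X :=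
  fun x hx y hy => hX y hy x hx

theorem IsTotallyIsotropic.orthogonal_eq [Module.Finite K V] (hB : B.Nondegenerate)
    (hX : IsTotallyIsotropic B X) (hdim : 2 * finrank K X = finrank K V) :
    B.orthogonal X = X := by
  have horth := LinearMap.BilinForm.finrank_orthogonal hB X
  exact (Submodule.eq_of_le_of_finrank_eq hX.le_orthogonal (by omega)).symm

theorem IsTotallyIsotropic.two_mul_finrank_le [Module.Finite K V] (hB : B.Nondegenerate)
    (hX : IsTotallyIsotropic B X) : 2 * finrank K X ≤ finrank K V := by
  have horth := LinearMap.BilinForm.finrank_orthogonal hB X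
  have hle := Submodule.finrank_mono hX.le_orthogonal
  have hXV := Submodule.finrank_le X
  omega

theorem IsTotallyIsotropic.sup_span_singleton (hB : B.IsAlt) (hX : IsTotallyIsotropic B X) {v : V}
    (hv : v ∈ B.orthogonal X) : IsTotallyIsotropic B (X ⊔ Submodule.span K {v}) := by
  intro x hx y hy
  obtain ⟨x', hx', a, ha, rfl⟩ := Submodule.mem_sup.mp hx
  obtain ⟨y', hy', b, hb, rfl⟩ := Submodule.mem_sup.mp hy
  obtain ⟨c, rfl⟩ := Submodule.mem_span_singleton.mp ha
  obtain ⟨d, rfl⟩ := Submodule.mem_span_singleton.mp hb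
  have hxv : B x' v = 0 := hv x' hx'
  have hvy : B v y' = 0 := hB.isRefl _ _ (hv y' hy')
  simp [hxv, hvy, hX x' hx' y' hy', hB.self_eq_zero v]

theorem exists_isTotallyIsotropic_disjoint [Module.Finite K V] (hB : B.IsAlt)
    (U : Submodule K V) :
    ∃ X, IsTotallyIsotropic B X ∧ Disjoint X U ∧ B.orthogonal X ≤ X ⊔ U := by
  obtain ⟨X, ⟨hX, hXU⟩, hmax⟩ := exists_maximal_of_wellFoundedGT
    (fun X => IsTotallyIsotropic B X ∧ Disjoint X U)
    ⟨⊥, isTotallyIsotropic_bot B, disjoint_bot_left⟩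
  refine ⟨X, hX, hXU, fun v hv => by_contra fun hvXU => ?_⟩
  have hv0 : v ≠ 0 := fun h => hvXU (h ▸ zero_mem _)
  have hdisj : Disjoint (X ⊔ Submodule.span K {v}) U := by
    rw [sup_comm]
    exact hXU.disjoint_sup_left_of_disjoint_sup_right
      ((Submodule.disjoint_span_singleton' hv0).mpr hvXU).symm
  have hle := hmax ⟨hX.sup_span_singleton hB hv, hdisj⟩ le_sup_left
  exact hvXU (Submodule.mem_sup_left
    (hle (Submodule.mem_sup_right (Submodule.mem_span_singleton_self v))))

theorem exists_isCompl_isTotallyIsotropic [Module.Finite K V] (hB : B.Nondegenerate)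
    (halt : B.IsAlt) : ∃ U X, IsTotallyIsotropic B U ∧ IsTotallyIsotropic B X ∧ IsCompl U X := by
  obtain ⟨U, hU, -, hUorth⟩ := exists_isTotallyIsotropic_disjoint halt ⊥
  rw [sup_bot_eq] at hUorth
  obtain ⟨X, hX, hXU, hXorth⟩ := exists_isTotallyIsotropic_disjoint halt U
  have horth : B.orthogonal (X ⊔ U) = ⊥ := by
    refine le_bot_iff.mp ((le_inf ?_ ?_).trans hXU.le_bot)
    · exact (LinearMap.BilinForm.orthogonal_le hXorth).trans_eq
        (LinearMap.BilinForm.orthogonal_orthogonal hB halt.isRefl X)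
    · exact (LinearMap.BilinForm.orthogonal_le le_sup_right).trans hUorth
  refine ⟨U, X, hU, hX, hXU.symm, codisjoint_iff.mpr ?_⟩
  rw [sup_comm, ← LinearMap.BilinForm.orthogonal_orthogonal hB halt.isRefl (X ⊔ U), horth,
    LinearMap.BilinForm.orthogonal_bot]

end Isotropic

section Hyperbolic

variable {K V : Type*} [Field K] [AddCommGroup V] [Module K V] [Module.Finite K V]
  {B : LinearMap.BilinForm K V} {U X : Submodule K V}

theorem IsTotallyIsotropic.exists_dual_equiv (hB : B.Nondegenerate) (hU : IsTotallyIsotropic B U)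
    (hUX : IsCompl U X) (hdim : finrank K U = finrank K X) :
    ∃ p : U ≃ₗ[K] Dual K X, ∀ u x, p u x = B u x := by
  refine ⟨LinearEquiv.ofInjectiveOfFinrankEq (B.domRestrict₁₂ U X) ?_
    (hdim.trans Subspace.dual_finrank_eq.symm), fun _ _ => rfl⟩
  refine (injective_iff_map_eq_zero _).mpr fun u hu => Subtype.ext (hB.1 _ fun v => ?_)
  obtain ⟨a, ha, x, hx, rfl⟩ := Submodule.mem_sup.mp (hUX.sup_eq_top ▸ Submodule.mem_top : v ∈ _)
  have hux : B u x = 0 := LinearMap.congr_fun hu ⟨x, hx⟩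
  rw [map_add, hU u u.2 a ha, hux, add_zero]

theorem IsTotallyIsotropic.exists_dualProd_equiv {M : Type*} [AddCommGroup M] [Module K M]
    (hB : B.Nondegenerate) (hU : IsTotallyIsotropic B U) (hUX : IsCompl U X)
    (hdim : finrank K U = finrank K X) (φ : M ≃ₗ[K] X) :
    ∃ (i : Dual K M → U) (e : (Dual K M × M) ≃ₗ[K] V),
      (∀ x, e x = i x.1 + φ x.2) ∧ ∀ f y, B (i f) (φ y) = f y := by
  obtain ⟨p, hp⟩ := hU.exists_dual_equiv hB hUX hdim
  let i : Dual K M ≃ₗ[K] U := φ.dualMap.symm.trans p.symm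
  refine ⟨i, (i.prodCongr φ).trans (Submodule.prodEquivOfIsCompl U X hUX), fun _ => rfl,
    fun f y => ?_⟩
  rw [← hp, show p (i f) = φ.dualMap.symm f from p.apply_symm_apply _]
  exact congrArg f (φ.symm_apply_apply y)

theorem IsTotallySingular.exists_isCompl {Q : QuadraticForm K V}
    (hQ : Q.polarBilin.Nondegenerate) (hU : IsTotallySingular Q U)
    (hdim : 2 * finrank K U = finrank K V) : ∃ X, IsTotallySingular Q X ∧ IsCompl U X := by
  obtain ⟨X, hUX⟩ := U.exists_isCompl
  have hsum := Submodule.finrank_add_eq_of_isCompl hUX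
  obtain ⟨p, hp⟩ := hU.isTotallyIsotropic.exists_dual_equiv hQ hUX (by omega)
  -- Subtracting from `x` the vector `ρ x ∈ U` with `polar Q (ρ x) y = β x y` makes it singular.
  obtain ⟨β, hβ⟩ := LinearMap.BilinMap.toQuadraticMap_surjective (Q.comp X.subtype)
  let ρ : X →ₗ[K] U := p.symm.toLinearMap ∘ₗ β
  have hQρ (x : X) : Q (x - ρ x) = 0 := by
    have hβx : β x x = Q x := DFunLike.congr_fun hβ x
    have hρx : QuadraticMap.polar Q (ρ x) x = β x x :=
      (hp _ _).symm.trans (LinearMap.congr_fun (p.apply_symm_apply (β x)) x)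
    rw [sub_eq_add_neg, QuadraticMap.map_add Q, QuadraticMap.map_neg, hU _ (ρ x).2,
      QuadraticMap.polar_neg_right, QuadraticMap.polar_comm, hρx, hβx, add_zero, add_neg_cancel]
  refine ⟨LinearMap.range (X.subtype - U.subtype ∘ₗ ρ), ?_, ?_, ?_⟩
  · rintro _ ⟨x, rfl⟩
    exact hQρ x
  · rw [Submodule.disjoint_def]
    rintro _ hxU ⟨x, rfl⟩
    have hx : (x : V) ∈ U := (Submodule.sub_mem_iff_left U (ρ x).2).mp hxU
    rw [show x = 0 from Subtype.ext (Submodule.disjoint_def.mp hUX.disjoint _ hx x.2), map_zero]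
  · rw [codisjoint_iff, Submodule.eq_top_iff']
    intro v
    obtain ⟨u, hu, x, hx, rfl⟩ := Submodule.mem_sup.mp (hUX.sup_eq_top ▸ Submodule.mem_top : v ∈ _)
    exact Submodule.mem_sup.mpr ⟨u + ρ ⟨x, hx⟩, U.add_mem hu (ρ ⟨x, hx⟩).2, _, ⟨⟨x, hx⟩, rfl⟩,
      by simp⟩

end Hyperbolic

section Classification

variable {K V : Type*} [Field K] [AddCommGroup V] [Module K V]

theorem IsOrthogonalPlusSpace.equivalent_dualProd {Q : QuadraticForm K V} {n : ℕ}
    (hQ : IsOrthogonalPlusSpace Q n) (M : Type*) [AddCommGroup M] [Module K M]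
    [Module.Finite K M] (hM : finrank K M = n) : (QuadraticForm.dualProd K M).Equivalent Q := by
  have := hQ.finite
  have hV := hQ.finrank_eq
  obtain ⟨U, hU, hUn⟩ := hQ.exists_singular
  obtain ⟨X, hX, hUX⟩ := hU.exists_isCompl hQ.nondegenerate (by omega)
  have hsum := Submodule.finrank_add_eq_of_isCompl hUX
  let φ : M ≃ₗ[K] X := LinearEquiv.ofFinrankEq _ _ (by omega)
  obtain ⟨i, e, he, hi⟩ :=
    hU.isTotallyIsotropic.exists_dualProd_equiv hQ.nondegenerate hUX (by omega) φ
  refine ⟨{ e with map_app' := fun x => ?_ }⟩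
  change Q (e x) = x.1 x.2
  rw [he, QuadraticMap.map_add Q, hU _ (i _).2, hX _ (φ _).2, zero_add, zero_add]
  exact hi _ _

theorem IsSymplecticSpace.exists_dualProd_equiv {B : LinearMap.BilinForm K V} {n : ℕ}
    (hB : IsSymplecticSpace B (2 * n)) (M : Type*) [AddCommGroup M] [Module K M]
    [Module.Finite K M] (hM : finrank K M = n) :
    ∃ e : (Dual K M × M) ≃ₗ[K] V, ∀ x y, B (e x) (e y) = x.1 y.2 - y.1 x.2 := by
  have := hB.finite
  have hV := hB.finrank_eq
  obtain ⟨U, X, hU, hX, hUX⟩ := exists_isCompl_isTotallyIsotropic hB.nondegenerate hB.isAlt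
  have hUdim := hU.two_mul_finrank_le hB.nondegenerate
  have hXdim := hX.two_mul_finrank_le hB.nondegenerate
  have hsum := Submodule.finrank_add_eq_of_isCompl hUX
  let φ : M ≃ₗ[K] X := LinearEquiv.ofFinrankEq _ _ (by omega)
  obtain ⟨i, e, he, hi⟩ := hU.exists_dualProd_equiv hB.nondegenerate hUX (by omega) φ
  refine ⟨e, fun x y => ?_⟩
  rw [he, he, map_add, map_add, LinearMap.add_apply, LinearMap.add_apply, hi,
    hU _ (i _).2 _ (i _).2, hX _ (φ _).2 _ (φ _).2, ← hB.isAlt.neg_eq, hi]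
  ring

theorem IsSymplecticSpace.equivalent {V' : Type*} [AddCommGroup V'] [Module K V']
    {B : LinearMap.BilinForm K V} {B' : LinearMap.BilinForm K V'} {n : ℕ}
    (hB : IsSymplecticSpace B (2 * n)) (hB' : IsSymplecticSpace B' (2 * n)) : B.Equivalent B' := by
  obtain ⟨e, he⟩ := hB.exists_dualProd_equiv (Fin n → K) (finrank_fin_fun K)
  obtain ⟨e', he'⟩ := hB'.exists_dualProd_equiv (Fin n → K) (finrank_fin_fun K)
  refine ⟨{ e.symm.trans e' with map_app' := fun x y => ?_ }⟩
  change B' (e' (e.symm x)) (e' (e.symm y)) = B x y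
  rw [he', ← he, e.apply_symm_apply, e.apply_symm_apply]

end Classification

section Maximality

variable {K V : Type*} [Field K] [AddCommGroup V] [Module K V] {S : Set (Submodule K V)}

theorem maximal_of_forall_exists_inf_ne_bot {P : Set (Submodule K V) → Prop}
    (hP : ∀ T, P T → IsPartialSpread K V T) (hS : P S)
    (hmeet : ∀ T, P T → ∀ Y ∈ T, ∃ X ∈ S, Y ⊓ X ≠ ⊥) : Maximal P S := by
  refine ⟨hS, fun T hT hST Y hY => ?_⟩
  obtain ⟨X, hX, hYX⟩ := hmeet T hT Y hY
  obtain rfl : Y = X := by_contra fun hne => hYX ((hP T hT).inf_eq_bot Y hY X (hST hX) hne)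
  exact hX

end Maximality

section Transport

variable {K V V' : Type*} [Field K] [AddCommGroup V] [Module K V] [AddCommGroup V'] [Module K V']

theorem IsPartialSpread.map {S : Set (Submodule K V)} (hS : IsPartialSpread K V S)
    (e : V ≃ₗ[K] V') : IsPartialSpread K V' (Submodule.map (e : V →ₗ[K] V') '' S) := by
  constructor
  · rintro _ ⟨X, hX, rfl⟩
    rw [LinearEquiv.finrank_map_eq, hS.half_dim X hX, e.finrank_eq]
  · rintro _ ⟨X, hX, rfl⟩ _ ⟨Y, hY, rfl⟩ hne
    rw [← Submodule.map_inf _ e.injective, hS.inf_eq_bot X hX Y hY fun h => hne (h ▸ rfl),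
      Submodule.map_bot]

theorem IsOrthogonalSpread.map {Q : QuadraticForm K V} {Q' : QuadraticForm K V'}
    {S : Set (Submodule K V)} (hS : IsOrthogonalSpread Q S) (e : Q.IsometryEquiv Q') :
    IsOrthogonalSpread Q' (Submodule.map (e.toLinearEquiv : V →ₗ[K] V') '' S) := by
  refine ⟨⟨hS.1.1.map e.toLinearEquiv, ?_⟩, fun v hv => ?_⟩
  · rintro _ ⟨X, hX, rfl⟩ _ ⟨x, hx, rfl⟩
    exact (e.map_app x).trans (hS.1.2 X hX x hx)
  · obtain ⟨X, hX, hvX⟩ := hS.2 (e.symm v) ((e.symm.map_app v).trans hv)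
    exact ⟨_, ⟨X, hX, rfl⟩, e.symm v, hvX, e.apply_symm_apply v⟩

variable {B : LinearMap.BilinForm K V} {B' : LinearMap.BilinForm K V'}

theorem IsSymplecticPartialSpread.map {S : Set (Submodule K V)}
    (hS : IsSymplecticPartialSpread B S) (e : B.IsometryEquiv B') :
    IsSymplecticPartialSpread B' (Submodule.map (e.toLinearEquiv : V →ₗ[K] V') '' S) := by
  refine ⟨hS.1.map e.toLinearEquiv, ?_⟩
  rintro _ ⟨X, hX, rfl⟩ _ ⟨x, hx, rfl⟩ _ ⟨y, hy, rfl⟩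
  exact (e.map_app y x).trans (hS.2 X hX x hx y hy)

theorem maximal_isSymplecticPartialSpread_map {S : Set (Submodule K V)}
    (hS : Maximal (IsSymplecticPartialSpread B) S) (e : B.IsometryEquiv B') :
    Maximal (IsSymplecticPartialSpread B')
      (Submodule.map (e.toLinearEquiv : V →ₗ[K] V') '' S) := by
  refine ⟨hS.1.map e, fun T hT hST Y hY => ?_⟩
  have hle := hS.2 (hT.map e.symm) fun X hX =>
    ⟨_, hST ⟨X, hX, rfl⟩, (Submodule.map_symm_eq_iff e.toLinearEquiv).mpr rfl⟩
  exact ⟨_, hle ⟨Y, hY, rfl⟩, (Submodule.map_symm_eq_iff e.toLinearEquiv).mp rfl⟩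

theorem ncard_image_map_equiv (S : Set (Submodule K V)) (e : V ≃ₗ[K] V') :
    (Submodule.map (e : V →ₗ[K] V') '' S).ncard = S.ncard :=
  Set.ncard_image_of_injective _ (Submodule.map_injective_of_injective e.injective)

end Transport

section Counting

variable {K V : Type*} [Field K] [AddCommGroup V] [Module K V]

theorem natCard_fiber_of_ne_zero [Module.Finite K V] {φ : Dual K V} (hφ : φ ≠ 0) (c : K) :
    Nat.card {u // φ u = c} = Nat.card K ^ (finrank K V - 1) := by
  obtain ⟨u₀, rfl⟩ := LinearMap.surjective hφ c
  have e : {u // φ u = φ u₀} ≃ LinearMap.ker φ :=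
    (Equiv.subRight u₀).subtypeEquiv fun u => by simp [sub_eq_zero]
  rw [Nat.card_congr e, Module.natCard_eq_pow_finrank (K := K),
    ← Module.Dual.finrank_ker_add_one_of_ne_zero hφ, Nat.add_sub_cancel]

theorem IsTotallySingular.natCard_singular_coset {Q : QuadraticForm K V} {X : Submodule K V}
    [Module.Finite K X] (hX : IsTotallySingular Q X) {v : V}
    (hv : v ∉ LinearMap.BilinForm.orthogonal Q.polarBilin X) :
    Nat.card {u : X // Q (v + u) = 0} = Nat.card K ^ (finrank K X - 1) := by
  let φ : Dual K X := Q.polarBilin v ∘ₗ X.subtype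
  have hφ : φ ≠ 0 := fun h => hv fun u hu =>
    (QuadraticMap.polar_comm Q u v).trans (LinearMap.congr_fun h ⟨u, hu⟩)
  have hsing (u : X) : Q (v + u) = 0 ↔ φ u = -Q v := by
    rw [QuadraticMap.map_add Q, hX _ u.2, add_zero, add_comm, ← eq_neg_iff_add_eq_zero]
    rfl
  rw [Nat.card_congr (Equiv.subtypeEquivRight hsing), natCard_fiber_of_ne_zero hφ]

theorem existsUnique_add_mem_of_isCompl {X Y : Submodule K V} (hXY : IsCompl X Y) (v : V) :
    ∃! u : X, v + u ∈ Y := by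
  obtain ⟨x, hx, y, hy, rfl⟩ := Submodule.mem_sup.mp (hXY.sup_eq_top ▸ Submodule.mem_top : v ∈ _)
  refine ⟨-⟨x, hx⟩, by simpa using hy, fun u hu => eq_neg_of_add_eq_zero_right (Subtype.ext ?_)⟩
  refine Submodule.disjoint_def.mp hXY.disjoint _ (X.add_mem hx u.2) ?_
  rwa [Submodule.coe_add, ← Submodule.add_mem_iff_left _ hy, add_right_comm]

variable [Module.Finite K V] {S : Set (Submodule K V)}

theorem IsPartialSpread.isCompl (hS : IsPartialSpread K V S) {X Y : Submodule K V} (hX : X ∈ S)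
    (hY : Y ∈ S) (hne : X ≠ Y) : IsCompl X Y := by
  have hinf := hS.inf_eq_bot X hX Y hY hne
  refine ⟨disjoint_iff.mpr hinf, codisjoint_iff.mpr (Submodule.eq_top_of_finrank_eq ?_)⟩
  have hsum := Submodule.finrank_sup_add_finrank_inf_eq X Y
  rw [hinf, finrank_bot] at hsum
  have hXdim := hS.half_dim X hX
  have hYdim := hS.half_dim Y hY
  omega

variable {Q : QuadraticForm K V}

theorem IsOrthogonalPartialSpread.exists_injective_singular_coset
    (hS : IsOrthogonalPartialSpread Q S) {X₀ : Submodule K V} (hX₀ : X₀ ∈ S) {v : V}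
    (hv : v ∉ X₀) : ∃ g : ↥(S \ {X₀}) → {u : X₀ // Q (v + u) = 0},
      Function.Injective g ∧ ∀ X u, g X = u ↔ v + u.1 ∈ X.1 := by
  choose g hgmem hguniq using fun X : ↥(S \ {X₀}) =>
    existsUnique_add_mem_of_isCompl (hS.1.isCompl hX₀ X.2.1 (Ne.symm X.2.2)) v
  refine ⟨fun X => ⟨g X, hS.2 X X.2.1 _ (hgmem X)⟩, fun X Y hXY => ?_, fun X u => ?_⟩
  · have hgXY : g X = g Y := congrArg Subtype.val hXY
    by_contra hne
    have hmem : v + g X ∈ X.1 ⊓ Y.1 := ⟨hgmem X, hgXY ▸ hgmem Y⟩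
    rw [hS.1.inf_eq_bot _ X.2.1 _ Y.2.1 (Subtype.coe_ne_coe.mpr hne), Submodule.mem_bot] at hmem
    exact hv (eq_neg_of_add_eq_zero_left hmem ▸ X₀.neg_mem (g X).2)
  · rw [Subtype.ext_iff]
    exact ⟨fun h => h ▸ hgmem X, fun h => (hguniq X _ h).symm⟩

theorem IsOrthogonalPartialSpread.natCard_singular_coset (hQ : Q.polarBilin.Nondegenerate)
    (hS : IsOrthogonalPartialSpread Q S) {X₀ : Submodule K V} (hX₀ : X₀ ∈ S) {v : V}
    (hv : v ∉ X₀) :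
    Nat.card {u : X₀ // Q (v + u) = 0} = Nat.card K ^ (finrank K V / 2 - 1) := by
  have hdim := hS.1.half_dim X₀ hX₀
  have hX₀s : IsTotallySingular Q X₀ := hS.2 X₀ hX₀
  rw [← hX₀s.isTotallyIsotropic.orthogonal_eq hQ hdim] at hv
  rw [hX₀s.natCard_singular_coset hv, show finrank K X₀ = finrank K V / 2 by omega]

theorem IsOrthogonalPartialSpread.isOrthogonalSpread_iff_ncard [Finite K] [Nontrivial V]
    (hQ : Q.polarBilin.Nondegenerate) (hS : IsOrthogonalPartialSpread Q S) :
    IsOrthogonalSpread Q S ↔ S.ncard = Nat.card K ^ (finrank K V / 2 - 1) + 1 := by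
  have : Finite V := Module.finite_of_finite K
  have hncard {X₀} (hX₀ : X₀ ∈ S) : S.ncard = Nat.card ↥(S \ {X₀}) + 1 := by
    rw [Nat.card_coe_set_eq, Set.ncard_sdiff_singleton_add_one hX₀]
  refine ⟨fun hspread => ?_, fun hcard => ⟨hS, fun v hv => ?_⟩⟩
  · obtain ⟨X₀, hX₀, -⟩ := hspread.2 0 (QuadraticMap.map_zero Q)
    obtain ⟨v, hv⟩ : ∃ v, v ∉ X₀ := by
      by_contra! htop
      have hdim := hS.1.half_dim X₀ hX₀
      rw [Submodule.eq_top_iff'.mpr htop, finrank_top] at hdim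
      have := finrank_pos (R := K) (M := V)
      omega
    obtain ⟨g, hg, hmem⟩ := hS.exists_injective_singular_coset hX₀ hv
    have hsurj : Function.Surjective g := fun u => by
      obtain ⟨X, hX, hvX⟩ := hspread.2 _ u.2
      have hne : X ≠ X₀ := fun h => hv ((Submodule.add_mem_iff_left _ u.1.2).mp (h ▸ hvX))
      exact ⟨⟨X, hX, hne⟩, (hmem _ _).mpr hvX⟩
    rw [hncard hX₀, Nat.card_congr (Equiv.ofBijective g ⟨hg, hsurj⟩),
      hS.natCard_singular_coset hQ hX₀ hv]
  · obtain ⟨X₀, hX₀⟩ : S.Nonempty := Set.nonempty_of_ncard_ne_zero (by omega)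
    by_cases hvX₀ : v ∈ X₀
    · exact ⟨X₀, hX₀, hvX₀⟩
    obtain ⟨g, hg, hmem⟩ := hS.exists_injective_singular_coset hX₀ hvX₀
    have hle : Nat.card {u : X₀ // Q (v + u) = 0} ≤ Nat.card ↥(S \ {X₀}) := by
      rw [hS.natCard_singular_coset hQ hX₀ hvX₀]
      have := hncard hX₀
      omega
    obtain ⟨X, hX⟩ := (hg.bijective_of_nat_card_le hle).2 ⟨0, by simpa using hv⟩
    exact ⟨X, X.2.1, by simpa using (hmem _ _).mp hX⟩

end Counting

section DualGraph

variable {K M : Type*} [Field K] [AddCommGroup M] [Module K M]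

theorem polar_dualProd (x y : Dual K M × M) :
    QuadraticMap.polar (QuadraticForm.dualProd K M) x y = x.1 y.2 + y.1 x.2 := by
  simp only [QuadraticMap.polar, QuadraticForm.dualProd_apply, Prod.fst_add, Prod.snd_add,
    LinearMap.add_apply, map_add]
  ring

theorem nondegenerate_polarBilin_of_separatingLeft {Q : QuadraticForm K M}
    (h : Q.polarBilin.SeparatingLeft) : Q.polarBilin.Nondegenerate :=
  ⟨h, fun x hx => h x fun y => (QuadraticMap.polar_comm Q x y).trans (hx y)⟩

theorem isTotallySingular_range_inl :
    IsTotallySingular (QuadraticForm.dualProd K M)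
      (LinearMap.range (LinearMap.inl K (Dual K M) M)) := by
  rintro _ ⟨f, rfl⟩
  simp

/-- The graph `{(A v, v)}` of `A : M → M*`, a typical complement of `M* × 0` in the hyperbolic
space `M* × M`; the factors are ordered as in `QuadraticForm.dualProd`. -/
def dualGraph (A : LinearMap.BilinForm K M) : Submodule K (Dual K M × M) :=
  LinearMap.range (A.prod LinearMap.id)

theorem mem_dualGraph {A : LinearMap.BilinForm K M} {x : Dual K M × M} :
    x ∈ dualGraph A ↔ A x.2 = x.1 :=
  ⟨by rintro ⟨v, rfl⟩; rfl, fun h => ⟨x.2, Prod.ext h rfl⟩⟩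

theorem finrank_dualGraph (A : LinearMap.BilinForm K M) :
    finrank K (dualGraph A) = finrank K M :=
  LinearMap.finrank_range_of_inj fun _ _ h => congrArg Prod.snd h

theorem isTotallySingular_dualGraph {A : LinearMap.BilinForm K M} (hA : A.IsAlt) :
    IsTotallySingular (QuadraticForm.dualProd K M) (dualGraph A) := fun x hx => by
  rw [QuadraticForm.dualProd_apply, ← mem_dualGraph.mp hx, hA.self_eq_zero]

theorem dualGraph_inf_range_inl (A : LinearMap.BilinForm K M) :
    dualGraph A ⊓ LinearMap.range (LinearMap.inl K (Dual K M) M) = ⊥ := by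
  refine (Submodule.eq_bot_iff _).mpr fun x ⟨hxA, f, hf⟩ => ?_
  have hx2 : x.2 = 0 := (congrArg Prod.snd hf).symm
  exact Prod.ext (by rw [← mem_dualGraph.mp hxA, hx2, map_zero]; rfl) hx2

theorem dualGraph_inf_dualGraph {A A' : LinearMap.BilinForm K M}
    (h : ∀ v, A v = A' v → v = 0) : dualGraph A ⊓ dualGraph A' = ⊥ := by
  refine (Submodule.eq_bot_iff _).mpr fun x ⟨hxA, hxA'⟩ => ?_
  rw [SetLike.mem_coe, mem_dualGraph] at hxA hxA'
  have hx2 : x.2 = 0 := h _ (hxA.trans hxA'.symm)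
  exact Prod.ext (by rw [← hxA, hx2, map_zero]; rfl) hx2

variable [Module.Finite K M]

theorem finrank_dual_prod : finrank K (Dual K M × M) = 2 * finrank K M := by
  rw [finrank_prod, Subspace.dual_finrank_eq, two_mul]

theorem isOrthogonalPlusSpace_dualProd :
    IsOrthogonalPlusSpace (QuadraticForm.dualProd K M) (finrank K M) := by
  refine ⟨inferInstance, finrank_dual_prod,
    nondegenerate_polarBilin_of_separatingLeft fun x hx => ?_, _, isTotallySingular_range_inl,
    (LinearMap.finrank_range_of_inj LinearMap.inl_injective).trans Subspace.dual_finrank_eq⟩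
  simp only [QuadraticMap.polarBilin_apply_apply, polar_dualProd] at hx
  refine Prod.ext (LinearMap.ext fun y => ?_) ((forall_dual_apply_eq_zero_iff K _).mp fun f => ?_)
  · simpa using hx (0, y)
  · simpa using hx (f, 0)

variable {ι : Type*} {A : ι → LinearMap.BilinForm K M}

theorem isOrthogonalPartialSpread_insert_dualGraph (halt : ∀ s, (A s).IsAlt)
    (hinj : ∀ v ≠ 0, Function.Injective fun s => A s v) :
    IsOrthogonalPartialSpread (QuadraticForm.dualProd K M)
      (insert (LinearMap.range (LinearMap.inl K (Dual K M) M))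
        (Set.range fun s => dualGraph (A s))) := by
  refine ⟨⟨?_, ?_⟩, ?_⟩
  · rintro _ (rfl | ⟨s, rfl⟩)
    · rw [LinearMap.finrank_range_of_inj LinearMap.inl_injective, Subspace.dual_finrank_eq,
        finrank_dual_prod]
    · rw [finrank_dualGraph, finrank_dual_prod]
  · rintro _ (rfl | ⟨s, rfl⟩) _ (rfl | ⟨t, rfl⟩) hne
    · exact absurd rfl hne
    · rw [inf_comm, dualGraph_inf_range_inl]
    · exact dualGraph_inf_range_inl _
    · exact dualGraph_inf_dualGraph fun v hv => by_contra fun hv0 => hne (by rw [hinj v hv0 hv])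
  · rintro _ (rfl | ⟨s, rfl⟩)
    · exact isTotallySingular_range_inl
    · exact isTotallySingular_dualGraph (halt s)

theorem isOrthogonalSpread_insert_dualGraph [Finite K] [Nontrivial M] (halt : ∀ s, (A s).IsAlt)
    (hinj : ∀ v ≠ 0, Function.Injective fun s => A s v)
    (hcard : Nat.card ι = Nat.card K ^ (finrank K M - 1)) :
    IsOrthogonalSpread (QuadraticForm.dualProd K M)
      (insert (LinearMap.range (LinearMap.inl K (Dual K M) M))
        (Set.range fun s => dualGraph (A s))) := by
  have : Finite ι :=
    Nat.finite_of_card_ne_zero (hcard.trans_ne (pow_ne_zero _ Nat.card_pos.ne'))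
  obtain ⟨v, hv⟩ := exists_ne (0 : M)
  have hmem (s : ι) : (A s v, v) ∈ dualGraph (A s) := mem_dualGraph.mpr rfl
  have hgraph : Function.Injective fun s => dualGraph (A s) := fun s t hst =>
    hinj v hv (mem_dualGraph.mp (hst.le (hmem s))).symm
  have hnotMem : LinearMap.range (LinearMap.inl K (Dual K M) M) ∉
      Set.range fun s => dualGraph (A s) := by
    rintro ⟨s, hs⟩
    obtain ⟨f, hf⟩ := hs.le (hmem s)
    exact hv (congrArg Prod.snd hf).symm
  rw [(isOrthogonalPartialSpread_insert_dualGraph halt hinj).isOrthogonalSpread_iff_ncard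
    isOrthogonalPlusSpace_dualProd.nondegenerate, Set.ncard_insert_of_notMem hnotMem,
    ← Nat.card_coe_set_eq, Nat.card_range_of_injective hgraph, hcard, finrank_dual_prod,
    Nat.mul_div_cancel_left _ two_pos]

end DualGraph

section Kerdock

variable {K L : Type*} [Field K] [Field L] [Algebra K L]

/-- Kantor's desarguesian Kerdock set, parametrized by `s : L`: with `Tr` the trace of `L / K`,
the form on `K × L` is
`((a, x), (b, y)) ↦ Tr (s x · s y) + (a + Tr (s x)) (b + Tr (s y)) - a b`. -/
noncomputable def kerdockForm (s : L) : LinearMap.BilinForm K (K × L) :=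
  let sx : K × L →ₗ[K] L := LinearMap.mulLeft K s ∘ₗ LinearMap.snd K K L
  let a : K × L →ₗ[K] K := LinearMap.fst K K L
  let l : K × L →ₗ[K] K := a + Algebra.trace K L ∘ₗ sx
  (Algebra.traceForm K L).compl₁₂ sx sx + (LinearMap.mul K K).compl₁₂ l l -
    (LinearMap.mul K K).compl₁₂ a a

theorem kerdockForm_apply (s : L) (u w : K × L) :
    kerdockForm s u w = Algebra.trace K L (s * u.2 * (s * w.2)) +
      (u.1 + Algebra.trace K L (s * u.2)) * (w.1 + Algebra.trace K L (s * w.2)) - u.1 * w.1 := rfl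

theorem kerdockForm_apply_eq_trace_add (s : L) (u w : K × L) :
    kerdockForm s u w = w.1 * Algebra.trace K L (s * u.2) + Algebra.trace K L
      ((s ^ 2 * u.2 + s * algebraMap K L (u.1 + Algebra.trace K L (s * u.2))) * w.2) := by
  set c := u.1 + Algebra.trace K L (s * u.2)
  have hsmul : s * algebraMap K L c * w.2 = c • (s * w.2) := by
    rw [Algebra.smul_def]
    ring
  rw [kerdockForm_apply, add_mul (s ^ 2 * u.2), hsmul, map_add, map_smul, smul_eq_mul,
    show s * u.2 * (s * w.2) = s ^ 2 * u.2 * w.2 by ring]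
  ring

variable [CharP K 2]

theorem trace_sq_of_charTwo [Finite L] (x : L) :
    Algebra.trace K L (x ^ 2) = Algebra.trace K L x ^ 2 := by
  have : CharP L 2 := charP_of_injective_algebraMap (algebraMap K L).injective 2
  apply (algebraMap K L).injective
  rw [map_pow (algebraMap K L), FiniteField.algebraMap_trace_eq_sum_pow,
    FiniteField.algebraMap_trace_eq_sum_pow, sum_pow_char 2]
  exact Finset.sum_congr rfl fun i _ => by rw [← pow_mul, ← pow_mul, mul_comm]

theorem isAlt_kerdockForm [Finite L] (s : L) : (kerdockForm (K := K) s).IsAlt := fun u => by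
  rw [kerdockForm_apply, ← pow_two, trace_sq_of_charTwo]
  linear_combination (u.1 * Algebra.trace K L (s * u.2) + Algebra.trace K L (s * u.2) ^ 2) *
    CharTwo.two_eq_zero (R := K)

theorem kerdockForm_injective [Finite L] (hodd : Odd (finrank K L)) {u : K × L} (hu : u ≠ 0) :
    Function.Injective fun s : L => kerdockForm s u := fun s t hst => by
  have : CharP L 2 := charP_of_injective_algebraMap (algebraMap K L).injective 2
  have htwo : (2 : L) = 0 := CharTwo.two_eq_zero
  by_contra hne
  have hsub : s - t ≠ 0 := sub_ne_zero.mpr hne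
  obtain ⟨a, x⟩ := u
  set c := Algebra.trace K L (s * x) with hc
  have hct : Algebra.trace K L (t * x) = c := by
    simpa [kerdockForm_apply_eq_trace_add] using (LinearMap.congr_fun hst (1, 0)).symm
  have heq : s ^ 2 * x + s * algebraMap K L (a + c) = t ^ 2 * x + t * algebraMap K L (a + c) := by
    refine sub_eq_zero.mp ((traceForm_nondegenerate K L).1 _ fun y => ?_)
    have hy := LinearMap.congr_fun hst (0, y)
    simp only [kerdockForm_apply_eq_trace_add, zero_mul, zero_add, hct] at hy
    rw [map_sub, LinearMap.sub_apply]
    exact sub_eq_zero.mpr hy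
  have hx : (s - t) * x = algebraMap K L (a + c) := by
    refine mul_left_cancel₀ hsub ?_
    linear_combination heq + (t ^ 2 * x - s * t * x - (s - t) * algebraMap K L (a + c)) * htwo
  -- The trace of the left side is `c - c`, that of the right side is `a + c`: the degree is odd.
  have hac : a + c = 0 := by
    have htrace := congrArg (Algebra.trace K L) hx
    rwa [sub_mul, map_sub, ← hc, hct, sub_self, Algebra.trace_algebraMap, nsmul_eq_mul,
      CharTwo.natCast_eq_ite, if_neg (Nat.not_even_iff_odd.mpr hodd), one_mul, eq_comm] at htrace
  have hx0 : x = 0 := by simpa [hac, hsub] using hx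
  have hc0 : c = 0 := by rw [hc, hx0, mul_zero, map_zero]
  exact hu (Prod.ext (by rwa [hc0, add_zero] at hac) hx0)

theorem IsOrthogonalPlusSpace.exists_isOrthogonalSpread [Finite K] {V : Type*}
    [AddCommGroup V] [Module K V] {Q : QuadraticForm K V} {m : ℕ} (hm : m ≠ 0)
    (hQ : IsOrthogonalPlusSpace Q (2 * m)) :
    ∃ S, IsOrthogonalSpread Q S := by
  have : Fact (Nat.Prime 2) := ⟨Nat.prime_two⟩
  have : NeZero (2 * m - 1) := ⟨by omega⟩
  let L := FiniteField.Extension K 2 (2 * m - 1)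
  have hL : finrank K L = 2 * m - 1 := FiniteField.finrank_extension K 2 (2 * m - 1)
  have hdim : finrank K (K × L) = 2 * m := by
    rw [finrank_prod, finrank_self, hL]
    omega
  obtain ⟨e⟩ := hQ.equivalent_dualProd (K × L) hdim
  have hS := isOrthogonalSpread_insert_dualGraph (K := K) (ι := L) isAlt_kerdockForm
    (fun v hv => kerdockForm_injective (by rw [hL]; exact ⟨m - 1, by omega⟩) hv)
    (by rw [Module.natCard_eq_pow_finrank (K := K), hdim, hL])
  exact ⟨_, hS.map e⟩

end Kerdock

section ChevalleyWarning

variable {K V : Type*} [Field K] [AddCommGroup V] [Module K V]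

theorem exists_mvPolynomial_eval_eq_quadraticForm {ι : Type*} [Finite ι] (b : Basis ι K V)
    (Q : QuadraticForm K V) :
    ∃ f : MvPolynomial ι K, f.totalDegree ≤ 2 ∧
      ∀ x, MvPolynomial.eval x f = Q (b.equivFun.symm x) := by
  have := Fintype.ofFinite ι
  obtain ⟨β, rfl⟩ := LinearMap.BilinMap.toQuadraticMap_surjective Q
  refine ⟨∑ i, ∑ j, MvPolynomial.C (β (b i) (b j)) * (MvPolynomial.X i * MvPolynomial.X j),
    ?_, fun x => ?_⟩
  · refine MvPolynomial.totalDegree_finsetSum_le fun i _ =>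
      MvPolynomial.totalDegree_finsetSum_le fun j _ => (MvPolynomial.totalDegree_mul _ _).trans ?_
    rw [MvPolynomial.totalDegree_C, zero_add]
    refine (MvPolynomial.totalDegree_mul _ _).trans ?_
    rw [MvPolynomial.totalDegree_X, MvPolynomial.totalDegree_X]
  · simp only [LinearMap.BilinMap.toQuadraticMap_apply, Basis.equivFun_symm_apply, map_sum,
      map_smul, LinearMap.sum_apply, LinearMap.smul_apply, map_mul, MvPolynomial.eval_C,
      MvPolynomial.eval_X, smul_eq_mul, Finset.mul_sum]
    exact Finset.sum_comm.trans
      (Finset.sum_congr rfl fun i _ => Finset.sum_congr rfl fun j _ => by ring)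

theorem exists_ne_zero_forall_quadraticForm_eq_zero [Finite K] [Module.Finite K V] {ι : Type*}
    [Fintype ι] (Q : ι → QuadraticForm K V) (h : 2 * Fintype.card ι < finrank K V) :
    ∃ v, v ≠ 0 ∧ ∀ i, Q i v = 0 := by
  classical
  have := Fintype.ofFinite K
  obtain ⟨p, _⟩ := CharP.exists K
  have hp : p.Prime := CharP.char_is_prime K p
  let b := finBasis K V
  choose f hdeg heval using fun i => exists_mvPolynomial_eval_eq_quadraticForm b (Q i)
  have hsum : ∑ i, (f i).totalDegree < Fintype.card (Fin (finrank K V)) := by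
    rw [Fintype.card_fin]
    refine (Finset.sum_le_card_nsmul _ _ 2 fun i _ => hdeg i).trans_lt ?_
    rwa [smul_eq_mul, mul_comm, Finset.card_univ]
  let zero : {x : Fin (finrank K V) → K // ∀ i, MvPolynomial.eval x (f i) = 0} :=
    ⟨0, fun i => by rw [heval, map_zero, QuadraticMap.map_zero]⟩
  have hcard := hp.one_lt.trans_le (Nat.le_of_dvd (Fintype.card_pos_iff.mpr ⟨zero⟩)
    (char_dvd_card_solutions_of_fintype_sum_lt p hsum))
  obtain ⟨⟨x, hx⟩, hne⟩ := Fintype.exists_ne_of_one_lt_card hcard zero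
  refine ⟨b.equivFun.symm x, fun h0 => hne (Subtype.ext ?_), fun i => by rw [← heval, hx]⟩
  exact (LinearEquiv.map_eq_zero_iff _).mp h0

end ChevalleyWarning

section RestrictScalars

variable {E F V : Type*} [Field E] [Field F] [Algebra E F] [AddCommGroup V] [Module F V]
  [Module E V] [IsScalarTower E F V] {Q : QuadraticForm F V} {S : Set (Submodule F V)}

theorem exists_singular_of_two_mul_finrank_lt [Finite E] [Module.Finite E F] {Y : Submodule E V}
    [Module.Finite E Y] (Q : QuadraticForm F V) (h : 2 * finrank E F < finrank E Y) :
    ∃ y ∈ Y, y ≠ 0 ∧ Q y = 0 := by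
  let b := finBasis E F
  obtain ⟨y, hy0, hy⟩ := exists_ne_zero_forall_quadraticForm_eq_zero
    (fun i => ((b.coord i).compQuadraticMap' Q).comp Y.subtype) (by rwa [Fintype.card_fin])
  refine ⟨y, y.2, Subtype.coe_ne_coe.mpr hy0, b.ext_elem fun i => ?_⟩
  rw [map_zero, Finsupp.zero_apply]
  exact hy i

theorem IsOrthogonalSpread.exists_restrictSpread_inf_ne_bot [Finite E] [Module.Finite E F]
    (hS : IsOrthogonalSpread Q S) {Y : Submodule E V} [Module.Finite E Y]
    (hY : 2 * finrank E F < finrank E Y) : ∃ X ∈ restrictSpread E S, Y ⊓ X ≠ ⊥ := by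
  obtain ⟨y, hyY, hy0, hy⟩ := exists_singular_of_two_mul_finrank_lt Q hY
  obtain ⟨X, hX, hyX⟩ := hS.2 y hy
  exact ⟨_, ⟨X, hX, rfl⟩, (Submodule.ne_bot_iff _).mpr ⟨y, ⟨hyY, hyX⟩, hy0⟩⟩

theorem finrank_restrictScalars_eq (X : Submodule F V) :
    finrank E (X.restrictScalars E) = finrank E F * finrank F X :=
  (finrank_mul_finrank E F X).symm

theorem IsTotallySingular.restrictScalars {X : Submodule F V} (hX : IsTotallySingular Q X) :
    IsTotallySingular (traceForm E Q) (X.restrictScalars E) :=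
  fun x hx => by rw [traceForm_apply, hX x hx, map_zero]

theorem IsPartialSpread.restrictScalars (hS : IsPartialSpread F V S) :
    IsPartialSpread E V (restrictSpread E S) := by
  constructor
  · rintro _ ⟨X, hX, rfl⟩
    rw [finrank_restrictScalars_eq, mul_left_comm, hS.half_dim X hX, finrank_mul_finrank]
  · rintro _ ⟨X, hX, rfl⟩ _ ⟨Y, hY, rfl⟩ hne
    rw [← Submodule.restrictScalars_inf, hS.inf_eq_bot X hX Y hY fun h => hne (h ▸ rfl),
      Submodule.restrictScalars_bot]

theorem IsOrthogonalPartialSpread.restrictScalars (hS : IsOrthogonalPartialSpread Q S) :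
    IsOrthogonalPartialSpread (traceForm E Q) (restrictSpread E S) := by
  refine ⟨hS.1.restrictScalars, ?_⟩
  rintro _ ⟨X, hX, rfl⟩
  exact (hS.2 X hX).restrictScalars

theorem polar_traceForm (x y : V) :
    QuadraticMap.polar (traceForm E Q) x y = Algebra.trace E F (QuadraticMap.polar Q x y) := by
  simp only [QuadraticMap.polar, traceForm_apply, map_sub]

theorem nondegenerate_polarBilin_traceForm [FiniteDimensional E F] [Algebra.IsSeparable E F]
    (hQ : Q.polarBilin.Nondegenerate) : (traceForm E Q).polarBilin.Nondegenerate := by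
  refine nondegenerate_polarBilin_of_separatingLeft fun x hx => hQ.1 x fun y => ?_
  refine (traceForm_nondegenerate E F).1 _ fun c => ?_
  rw [Algebra.traceForm_apply, mul_comm, QuadraticMap.polarBilin_apply_apply, ← smul_eq_mul,
    ← QuadraticMap.polar_smul_right, ← polar_traceForm]
  exact hx (c • y)

theorem IsOrthogonalPlusSpace.traceForm [FiniteDimensional E F] [Algebra.IsSeparable E F] {n : ℕ}
    (hQ : IsOrthogonalPlusSpace Q n) :
    IsOrthogonalPlusSpace (traceForm E Q) (n * finrank E F) := by
  have := hQ.finite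
  obtain ⟨U, hU, hn⟩ := hQ.exists_singular
  refine ⟨Module.Finite.trans F V, ?_, nondegenerate_polarBilin_traceForm hQ.nondegenerate,
    U.restrictScalars E, hU.restrictScalars, ?_⟩
  · rw [← finrank_mul_finrank E F V, hQ.finrank_eq]
    ring
  · rw [finrank_restrictScalars_eq, hn, mul_comm]

theorem IsOrthogonalSpread.maximal_restrictSpread [Finite E] [Module.Finite E F]
    [Module.Finite F V] (hS : IsOrthogonalSpread Q S) (hdim : 4 < finrank F V) :
    Maximal (IsPartialSpread E V) (restrictSpread E S) := by
  have : Module.Finite E V := Module.Finite.trans F V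
  have hpos : 0 < finrank E F := finrank_pos
  refine maximal_of_forall_exists_inf_ne_bot (fun _ => id) hS.1.1.restrictScalars
    fun T hT Y hY => hS.exists_restrictSpread_inf_ne_bot ?_
  have hYdim := hT.half_dim Y hY
  rw [← finrank_mul_finrank E F V] at hYdim
  nlinarith

theorem IsOrthogonalSpread.ncard_restrictSpread [Finite E] [Module.Finite E F] {n : ℕ}
    (hn : n ≠ 0) (hQ : IsOrthogonalPlusSpace Q n) (hS : IsOrthogonalSpread Q S) :
    (restrictSpread E S).ncard = Nat.card E ^ (n * finrank E F - finrank E F) + 1 := by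
  have := hQ.finite
  have : Finite F := Module.finite_of_finite E
  have hV := hQ.finrank_eq
  have : Nontrivial V := nontrivial_of_finrank_pos (R := F) (by omega)
  have hcard := (hS.1.isOrthogonalSpread_iff_ncard hQ.nondegenerate).mp hS
  rw [hV, Nat.mul_div_cancel_left _ two_pos] at hcard
  refine (Set.ncard_image_of_injective _ (Submodule.restrictScalars_injective E F V)).trans ?_
  rw [hcard, Module.natCard_eq_pow_finrank (K := E) (V := F), ← pow_mul, mul_comm, Nat.sub_mul,
    one_mul]

end RestrictScalars

section Projection

variable {K V : Type*} [Field K] [AddCommGroup V] [Module K V] {Q : QuadraticForm K V} {z : V}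
  {X Y : Submodule K V}

theorem mem_perp_iff {v : V} : v ∈ perp Q z ↔ QuadraticMap.polar Q z v = 0 := Iff.rfl

theorem map_add_smul_of_mem_perp {v : V} (hv : v ∈ perp Q z) (c : K) :
    Q (v + c • z) = Q v + c * c * Q z := by
  rw [QuadraticMap.map_add Q, QuadraticMap.polar_smul_right, QuadraticMap.polar_comm,
    mem_perp_iff.mp hv, QuadraticMap.map_smul, smul_zero, add_zero, smul_eq_mul]

theorem mkQ_lineInPerp_eq_iff {x y : perp Q z} :
    (lineInPerp Q z).mkQ x = (lineInPerp Q z).mkQ y ↔ ∃ c : K, (x : V) = y + c • z := by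
  rw [← sub_eq_zero, ← map_sub, ← LinearMap.mem_ker, Submodule.ker_mkQ]
  refine Submodule.mem_span_singleton.trans (exists_congr fun c => ?_)
  rw [Submodule.subtype_apply, Submodule.coe_sub, eq_sub_iff_add_eq, eq_comm, add_comm]

theorem projectSubspace_eq (Q : QuadraticForm K V) (z : V) (X : Submodule K V) :
    projectSubspace Q z X = (X.comap (perp Q z).subtype).map (lineInPerp Q z).mkQ := by
  apply le_antisymm
  · rintro _ ⟨w, hw, rfl⟩
    obtain ⟨a, ha, b, hb, hab⟩ := Submodule.mem_sup.mp hw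
    obtain ⟨c, rfl⟩ := Submodule.mem_span_singleton.mp hb
    exact ⟨⟨a, ha.1⟩, ha.2, (mkQ_lineInPerp_eq_iff.mpr ⟨c, hab.symm⟩).symm⟩
  · exact Submodule.map_mono fun w hw => Submodule.mem_sup_left ⟨w.2, hw⟩

theorem injOn_mkQ_lineInPerp (hz : Q z ≠ 0) :
    Set.InjOn (lineInPerp Q z).mkQ {x | Q x = 0} := fun x hx y hy hxy => by
  obtain ⟨c, hc⟩ := mkQ_lineInPerp_eq_iff.mp hxy
  have hQ := map_add_smul_of_mem_perp y.2 c
  rw [← hc, hx.out, hy.out, zero_add, zero_eq_mul, or_iff_left hz, mul_self_eq_zero] at hQ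
  exact Subtype.ext (by rw [hc, hQ, zero_smul, add_zero])

theorem finrank_projectSubspace (hz : Q z ≠ 0) (hX : IsTotallySingular Q X) :
    finrank K (projectSubspace Q z X) = finrank K ↥(perp Q z ⊓ X) := by
  have hinj : Function.Injective ((lineInPerp Q z).mkQ.domRestrict (X.comap (perp Q z).subtype)) :=
    fun x y hxy => Subtype.ext (injOn_mkQ_lineInPerp hz (hX _ x.2) (hX _ y.2) hxy)
  rw [projectSubspace_eq, ← LinearMap.range_domRestrict, LinearMap.finrank_range_of_inj hinj,
    ← Submodule.finrank_map_subtype_eq, Submodule.map_comap_subtype]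

theorem projectSubspace_inf (hz : Q z ≠ 0) (hX : IsTotallySingular Q X)
    (hY : IsTotallySingular Q Y) :
    projectSubspace Q z (X ⊓ Y) = projectSubspace Q z X ⊓ projectSubspace Q z Y := by
  simp only [projectSubspace_eq, Submodule.comap_inf]
  refine le_antisymm (Submodule.map_inf_le (lineInPerp Q z).mkQ) ?_
  rintro _ ⟨⟨x, hx, rfl⟩, y, hy, hyx⟩
  obtain rfl := injOn_mkQ_lineInPerp hz (hY _ hy) (hX _ hx) hyx
  exact ⟨y, ⟨hx, hy⟩, rfl⟩

theorem projectSubspace_ne_bot (hz : Q z ≠ 0) (hX : IsTotallySingular Q X) (hXz : X ≤ perp Q z)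
    (hX0 : X ≠ ⊥) : projectSubspace Q z X ≠ ⊥ := fun h => by
  obtain ⟨x, hx, hx0⟩ := (Submodule.ne_bot_iff X).mp hX0
  rw [projectSubspace_eq, Submodule.eq_bot_iff] at h
  have hmk := h _ ⟨⟨x, hXz hx⟩, hx, rfl⟩
  rw [← map_zero (lineInPerp Q z).mkQ] at hmk
  exact hx0 (congrArg Subtype.val
    (injOn_mkQ_lineInPerp hz (hX x hx) (QuadraticMap.map_zero Q) hmk))

theorem IsTotallySingular.isTotallyIsotropic_projectSubspace (hX : IsTotallySingular Q X) :
    IsTotallyIsotropic (quotientForm Q z) (projectSubspace Q z X) := by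
  rw [projectSubspace_eq]
  rintro _ ⟨x, hx, rfl⟩ _ ⟨y, hy, rfl⟩
  rw [quotientForm_mk]
  exact hX.isTotallyIsotropic _ hx _ hy

theorem IsTotallySingular.finrank_perp_inf_add_one [Module.Finite K V]
    (hQ : Q.polarBilin.Nondegenerate) (hX : IsTotallySingular Q X)
    (hdim : 2 * finrank K X = finrank K V) (hz : Q z ≠ 0) :
    finrank K ↥(perp Q z ⊓ X) + 1 = finrank K X := by
  let φ : Dual K X := Q.polarBilin z ∘ₗ X.subtype
  have hφ : φ ≠ 0 := fun h => hz <| hX z <| by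
    rw [← hX.isTotallyIsotropic.orthogonal_eq hQ hdim]
    exact fun x hx => (QuadraticMap.polar_comm Q x z).trans (LinearMap.congr_fun h ⟨x, hx⟩)
  rw [← Module.Dual.finrank_ker_add_one_of_ne_zero hφ, LinearMap.ker_comp, inf_comm,
    ← Submodule.map_comap_subtype, Submodule.finrank_map_subtype_eq]
  rfl

theorem IsTotallyIsotropic.exists_mem_iff_singular (hX : IsTotallyIsotropic Q.polarBilin X) :
    ∃ Z : Submodule K V, ∀ v, v ∈ Z ↔ v ∈ X ∧ Q v = 0 := by
  refine ⟨{ carrier := {v | v ∈ X ∧ Q v = 0}, zero_mem' := ?_, add_mem' := ?_, smul_mem' := ?_ },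
    fun _ => Iff.rfl⟩
  · rintro v w ⟨hv, hQv⟩ ⟨hw, hQw⟩
    have hvw : QuadraticMap.polar Q v w = 0 := hX v hv w hw
    exact ⟨X.add_mem hv hw, by rw [QuadraticMap.map_add Q, hQv, hQw, hvw, add_zero, add_zero]⟩
  · exact ⟨X.zero_mem, QuadraticMap.map_zero Q⟩
  · rintro c v ⟨hv, hQv⟩
    exact ⟨X.smul_mem c hv, by rw [QuadraticMap.map_smul, hQv, smul_zero]⟩

theorem eq_smul_of_perp_le_perp {x : V} (hQ : Q.polarBilin.Nondegenerate)
    (h : perp Q z ≤ perp Q x) : ∃ c : K, c • z = x := by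
  have hmem := mem_span_of_iInf_ker_le_ker
    (L := fun _ : Unit => Q.polarBilin z) (K := Q.polarBilin x)
    ((iInf_const (ι := Unit)).trans_le h)
  rw [Set.range_const, Submodule.mem_span_singleton] at hmem
  obtain ⟨c, hc⟩ := hmem
  refine ⟨c, sub_eq_zero.mp (hQ.1 _ fun y => ?_)⟩
  rw [map_sub, map_smul, hc, sub_self, LinearMap.zero_apply]

section CharTwo

variable [CharP K 2]

theorem polar_self_of_charTwo (Q : QuadraticForm K V) (x : V) : QuadraticMap.polar Q x x = 0 := by
  rw [QuadraticMap.polar_self, nsmul_eq_mul, Nat.cast_ofNat, CharTwo.two_eq_zero, zero_mul]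

theorem self_mem_perp (Q : QuadraticForm K V) (z : V) : z ∈ perp Q z :=
  polar_self_of_charTwo Q z

theorem finrank_perpQuotient_add_two [Module.Finite K V] (hQ : Q.polarBilin.Nondegenerate)
    (hz : z ≠ 0) : finrank K (PerpQuotient Q z) + 2 = finrank K V := by
  have hperp : finrank K (perp Q z) + 1 = finrank K V :=
    Module.Dual.finrank_ker_add_one_of_ne_zero fun h => hz (hQ.1 z (LinearMap.congr_fun h))
  have hline : finrank K (lineInPerp Q z) = 1 := by
    rw [← finrank_span_singleton (K := K) hz]
    exact (Submodule.comapSubtypeEquivOfLe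
      ((Submodule.span_singleton_le_iff_mem _ _).mpr (self_mem_perp Q z))).finrank_eq
  rw [← hperp, ← (lineInPerp Q z).finrank_quotient_add_finrank, hline]

theorem isAlt_quotientForm (Q : QuadraticForm K V) (z : V) : (quotientForm Q z).IsAlt := fun w => by
  obtain ⟨x, rfl⟩ := (lineInPerp Q z).mkQ_surjective w
  exact (quotientForm_mk Q z x x).trans (polar_self_of_charTwo Q x)

theorem nondegenerate_quotientForm (hQ : Q.polarBilin.Nondegenerate) (z : V) :
    (quotientForm Q z).Nondegenerate := by
  refine (isAlt_quotientForm Q z).isRefl.nondegenerate_iff_separatingLeft.mpr fun w hw => ?_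
  obtain ⟨x, rfl⟩ := (lineInPerp Q z).mkQ_surjective w
  obtain ⟨c, hc⟩ := eq_smul_of_perp_le_perp (z := z) (x := x) hQ fun y hy =>
    (quotientForm_mk Q z x ⟨y, hy⟩).symm.trans (hw _)
  rw [← map_zero (lineInPerp Q z).mkQ, mkQ_lineInPerp_eq_iff]
  exact ⟨c, by rw [hc, Submodule.coe_zero, zero_add]⟩

theorem isSymplecticSpace_quotientForm [Module.Finite K V] (hQ : Q.polarBilin.Nondegenerate)
    (hz : z ≠ 0) : IsSymplecticSpace (quotientForm Q z) (finrank K V - 2) :=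
  ⟨inferInstance, Nat.eq_sub_of_add_eq (finrank_perpQuotient_add_two hQ hz),
    isAlt_quotientForm Q z, nondegenerate_quotientForm hQ z⟩

theorem exists_singular_mkQ_lineInPerp_eq [PerfectRing K 2] (hz : Q z ≠ 0)
    (w : PerpQuotient Q z) : ∃ x : perp Q z, (lineInPerp Q z).mkQ x = w ∧ Q x = 0 := by
  obtain ⟨y, rfl⟩ := (lineInPerp Q z).mkQ_surjective w
  obtain ⟨c, hc⟩ := surjective_frobenius K 2 (Q y / Q z)
  rw [frobenius_def, pow_two] at hc
  refine ⟨y + c • ⟨z, self_mem_perp Q z⟩, mkQ_lineInPerp_eq_iff.mpr ⟨c, rfl⟩, ?_⟩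
  rw [Submodule.coe_add, Submodule.coe_smul, map_add_smul_of_mem_perp y.2, hc,
    div_mul_cancel₀ _ hz, CharTwo.add_self_eq_zero]

theorem IsTotallyIsotropic.exists_projectSubspace_eq [PerfectRing K 2] (hz : Q z ≠ 0)
    {Y : Submodule K (PerpQuotient Q z)} (hY : IsTotallyIsotropic (quotientForm Q z) Y) :
    ∃ Z ≤ perp Q z, IsTotallySingular Q Z ∧ projectSubspace Q z Z = Y := by
  let W : Submodule K V := (Y.comap (lineInPerp Q z).mkQ).map (perp Q z).subtype
  have hW : IsTotallyIsotropic Q.polarBilin W := by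
    rintro _ ⟨x, hx, rfl⟩ _ ⟨y, hy, rfl⟩
    exact (quotientForm_mk Q z x y).symm.trans (hY _ hx _ hy)
  obtain ⟨Z, hZ⟩ := hW.exists_mem_iff_singular
  refine ⟨Z, fun v hv => ?_, fun v hv => ((hZ v).mp hv).2, ?_⟩
  · obtain ⟨⟨x, -, rfl⟩, -⟩ := (hZ v).mp hv
    exact x.2
  rw [projectSubspace_eq]
  ext w
  constructor
  · rintro ⟨x, hx, rfl⟩
    obtain ⟨⟨x', hx', hxx'⟩, -⟩ := (hZ _).mp hx
    rwa [← Subtype.ext hxx']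
  · intro hw
    obtain ⟨x, rfl, hQx⟩ := exists_singular_mkQ_lineInPerp_eq hz w
    exact ⟨x, (hZ _).mpr ⟨⟨x, hw, rfl⟩, hQx⟩, rfl⟩

end CharTwo

variable {S : Set (Submodule K V)}

theorem IsOrthogonalPartialSpread.projectSubspace_inf_eq_bot
    (hS : IsOrthogonalPartialSpread Q S) (hz : Q z ≠ 0) (hX : X ∈ S) (hY : Y ∈ S) (hne : X ≠ Y) :
    projectSubspace Q z X ⊓ projectSubspace Q z Y = ⊥ := by
  rw [← projectSubspace_inf hz (hS.2 X hX) (hS.2 Y hY), hS.1.inf_eq_bot X hX Y hY hne,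
    projectSubspace_eq, Submodule.comap_bot, Submodule.ker_subtype, Submodule.map_bot]

variable [Module.Finite K V]

theorem IsOrthogonalPartialSpread.two_mul_finrank_projectSubspace_add_two
    (hQ : Q.polarBilin.Nondegenerate) (hS : IsOrthogonalPartialSpread Q S) (hz : Q z ≠ 0)
    (hX : X ∈ S) : 2 * finrank K (projectSubspace Q z X) + 2 = finrank K V := by
  have hdim := hS.1.half_dim X hX
  have hperp := (hS.2 X hX).finrank_perp_inf_add_one hQ hdim hz
  rw [finrank_projectSubspace hz (hS.2 X hX)]
  omega

theorem IsOrthogonalPartialSpread.ncard_image_projectSubspace (hQ : Q.polarBilin.Nondegenerate)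
    (hS : IsOrthogonalPartialSpread Q S) (hdim : 2 < finrank K V) (hz : Q z ≠ 0) :
    (projectSubspace Q z '' S).ncard = S.ncard := by
  refine Set.InjOn.ncard_image fun X hX Y hY h => by_contra fun hne => ?_
  have hbot := hS.projectSubspace_inf_eq_bot hz hX hY hne
  have hXdim := hS.two_mul_finrank_projectSubspace_add_two hQ hz hX
  rw [← h, inf_idem] at hbot
  rw [hbot, finrank_bot] at hXdim
  omega

theorem IsOrthogonalPartialSpread.isSymplecticPartialSpread_image_projectSubspace [CharP K 2]
    (hQ : Q.polarBilin.Nondegenerate) (hS : IsOrthogonalPartialSpread Q S) (hz : Q z ≠ 0) :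
    IsSymplecticPartialSpread (quotientForm Q z) (projectSubspace Q z '' S) := by
  have hz0 : z ≠ 0 := ne_zero_of_map hz
  refine ⟨⟨?_, ?_⟩, ?_⟩
  · rintro _ ⟨X, hX, rfl⟩
    have hXdim := hS.two_mul_finrank_projectSubspace_add_two hQ hz hX
    have hV := finrank_perpQuotient_add_two hQ hz0
    omega
  · rintro _ ⟨X, hX, rfl⟩ _ ⟨Y, hY, rfl⟩ hne
    exact hS.projectSubspace_inf_eq_bot hz hX hY fun h => hne (h ▸ rfl)
  · rintro _ ⟨X, hX, rfl⟩
    exact (hS.2 X hX).isTotallyIsotropic_projectSubspace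

theorem IsOrthogonalPartialSpread.maximal_image_projectSubspace [CharP K 2] [PerfectRing K 2]
    (hQ : Q.polarBilin.Nondegenerate) (hS : IsOrthogonalPartialSpread Q S) (hz : Q z ≠ 0)
    (hmeet : ∀ Z, IsTotallySingular Q Z → 2 * finrank K Z + 2 = finrank K V →
      ∃ X ∈ S, Z ⊓ X ≠ ⊥) :
    Maximal (IsSymplecticPartialSpread (quotientForm Q z)) (projectSubspace Q z '' S) := by
  refine maximal_of_forall_exists_inf_ne_bot (fun _ hT => hT.1)
    (hS.isSymplecticPartialSpread_image_projectSubspace hQ hz) fun T hT Y hY => ?_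
  obtain ⟨Z, hZz, hZ, rfl⟩ := (hT.2 Y hY).exists_projectSubspace_eq hz
  have hZdim : 2 * finrank K Z + 2 = finrank K V := by
    rw [← finrank_perpQuotient_add_two hQ (ne_zero_of_map hz),
      ← hT.1.half_dim _ hY, finrank_projectSubspace hz hZ, inf_eq_right.mpr hZz]
  obtain ⟨X, hX, hZX⟩ := hmeet Z hZ hZdim
  refine ⟨_, ⟨X, hX, rfl⟩, ?_⟩
  rw [← projectSubspace_inf hz hZ (hS.2 X hX)]
  exact projectSubspace_ne_bot hz (hZ.mono inf_le_left) (inf_le_left.trans hZz) hZX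

end Projection

section TraceProjection

theorem exists_map_ne_zero_of_nondegenerate {K V : Type*} [Field K] [AddCommGroup V]
    [Module K V] [Nontrivial V] {Q : QuadraticForm K V} (hQ : Q.polarBilin.Nondegenerate) :
    ∃ z, Q z ≠ 0 := by
  by_contra! h
  obtain ⟨x, hx⟩ := exists_ne (0 : V)
  exact hx (hQ.1 x fun y => by simp [QuadraticMap.polar, h])

variable {E : Type*} [Field E] [Finite E] [CharP E 2]

theorem IsOrthogonalSpread.maximal_image_projectSubspace_restrictSpread {F V : Type*} [Field F]
    [Algebra E F] [Module.Finite E F] [AddCommGroup V] [Module F V] [Module.Finite F V]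
    [Module E V] [IsScalarTower E F V] {Q : QuadraticForm F V} (hQ : Q.polarBilin.Nondegenerate)
    {S : Set (Submodule F V)} (hS : IsOrthogonalSpread Q S) (hdim : 6 < finrank F V) {z : V}
    (hz : traceForm E Q z ≠ 0) :
    Maximal (IsSymplecticPartialSpread (quotientForm (traceForm E Q) z))
      (projectSubspace (traceForm E Q) z '' restrictSpread E S) := by
  have : Module.Finite E V := Module.Finite.trans F V
  have hpos : 0 < finrank E F := finrank_pos
  refine hS.1.restrictScalars.maximal_image_projectSubspace
    (nondegenerate_polarBilin_traceForm hQ) hz fun Z _ hZ =>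
      hS.exists_restrictSpread_inf_ne_bot ?_
  rw [← finrank_mul_finrank E F V] at hZ
  nlinarith

theorem IsSymplecticSpace.exists_maximal_isSymplecticPartialSpread {W : Type*} [AddCommGroup W]
    [Module E W] {B : LinearMap.BilinForm E W} {k m : ℕ} (hk : k ≠ 0) (hm : 2 ≤ m)
    (hB : IsSymplecticSpace B (4 * m * k - 2)) :
    ∃ T, Maximal (IsSymplecticPartialSpread B) T ∧
      T.ncard = Nat.card E ^ (2 * m * k - k) + 1 := by
  have : Fact (Nat.Prime 2) := ⟨Nat.prime_two⟩
  have : NeZero k := ⟨hk⟩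
  let F := FiniteField.Extension E 2 k
  have hF : finrank E F = k := FiniteField.finrank_extension E 2 k
  have : CharP F 2 := charP_of_injective_algebraMap (algebraMap E F).injective 2
  have hQ : IsOrthogonalPlusSpace (QuadraticForm.dualProd F (Fin (2 * m) → F)) (2 * m) := by
    simpa only [finrank_fin_fun] using
      isOrthogonalPlusSpace_dualProd (K := F) (M := Fin (2 * m) → F)
  obtain ⟨S, hS⟩ := hQ.exists_isOrthogonalSpread (by omega)
  have hQ' := hQ.traceForm (E := E)
  have hV := hQ'.finrank_eq
  have hmk : 4 ≤ 2 * m * k := by nlinarith [Nat.pos_of_ne_zero hk]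
  rw [hF] at hV
  have := hQ'.finite
  have : Nontrivial (Dual F (Fin (2 * m) → F) × (Fin (2 * m) → F)) :=
    nontrivial_of_finrank_pos (R := E) (by omega)
  obtain ⟨z, hz⟩ := exists_map_ne_zero_of_nondegenerate hQ'.nondegenerate
  have hsymp := isSymplecticSpace_quotientForm hQ'.nondegenerate (ne_zero_of_map hz)
  rw [hV, ← Nat.mul_sub_one] at hsymp
  rw [show 4 * m * k - 2 = 2 * (2 * m * k - 1) by rw [Nat.mul_sub_one]; ring_nf] at hB
  obtain ⟨e⟩ := hsymp.equivalent hB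
  refine ⟨_, maximal_isSymplecticPartialSpread_map
    (hS.maximal_image_projectSubspace_restrictSpread hQ.nondegenerate ?_ hz) e, ?_⟩
  · rw [hQ.finrank_eq]
    omega
  · rw [ncard_image_map_equiv, hS.1.restrictScalars.ncard_image_projectSubspace hQ'.nondegenerate
      (by omega) hz, hS.ncard_restrictSpread (by omega) hQ, hF]

end TraceProjection

theorem charP_two_of_even_natCard {K : Type*} [Field K] [Finite K] (h : Even (Nat.card K)) :
    CharP K 2 := by
  have := Fintype.ofFinite K
  refine ringChar.of_eq (FiniteField.even_card_iff_char_two.mpr ?_)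
  rwa [← Nat.card_eq_fintype_card, ← Nat.even_iff]

end PartialSpread

open PartialSpread in
theorem mainTheorem4_general {E : Type*} [Field E] [Finite E] (q k m : ℕ)
    (hq : Nat.card E = q) (hq_even : Even q) (hk : 1 ≤ k)
    (hm : 2 ≤ m) :
    (∀ (W : Type*) [AddCommGroup W] [Module E W] (B : LinearMap.BilinForm E W),
      IsSymplecticSpace B (4 * m * k - 2) →
        ∃ T : Set (Submodule E W),
          Maximal (IsSymplecticPartialSpread B) T ∧ T.ncard = q ^ (2 * m * k - k) + 1) ∧
    (∀ (F V : Type*) [Field F] [Algebra E F] [AddCommGroup V] [Module F V] [Module E V]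
      [IsScalarTower E F V] (Q : QuadraticForm F V),
      Module.finrank E F = k → IsOrthogonalPlusSpace Q (2 * m) →
        (∃ S : Set (Submodule F V), IsOrthogonalSpread Q S) ∧
        IsOrthogonalPlusSpace (traceForm E Q) (2 * m * k) ∧
        ∀ S : Set (Submodule F V), IsOrthogonalSpread Q S →
          IsOrthogonalPartialSpread (traceForm E Q) (restrictSpread E S) ∧
          Maximal (IsPartialSpread E V) (restrictSpread E S) ∧
          (restrictSpread E S).ncard = q ^ (2 * m * k - k) + 1 ∧
          ∀ z : V, traceForm E Q z ≠ 0 →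
            IsSymplecticSpace (quotientForm (traceForm E Q) z) (4 * m * k - 2) ∧
            Maximal (IsSymplecticPartialSpread (quotientForm (traceForm E Q) z))
              (projectSubspace (traceForm E Q) z '' restrictSpread E S) ∧
            (projectSubspace (traceForm E Q) z '' restrictSpread E S).ncard =
              q ^ (2 * m * k - k) + 1) := by
  subst hq
  have := charP_two_of_even_natCard hq_even
  refine ⟨fun W _ _ B hB => hB.exists_maximal_isSymplecticPartialSpread (by omega) hm, ?_⟩
  rintro F V _ _ _ _ _ _ Q rfl hQ
  have : Module.Finite E F := Module.finite_of_finrank_pos hk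
  have : Finite F := Module.finite_of_finite E
  have : CharP F 2 := charP_of_injective_algebraMap (algebraMap E F).injective 2
  have := hQ.finite
  have hV := hQ.finrank_eq
  have hQ' := hQ.traceForm (E := E)
  have hV' := hQ'.finrank_eq
  have := hQ'.finite
  refine ⟨hQ.exists_isOrthogonalSpread (by omega), hQ', fun S hS => ?_⟩
  have hcard := hS.ncard_restrictSpread (E := E) (by omega) hQ
  refine ⟨hS.1.restrictScalars, hS.maximal_restrictSpread (by omega), hcard,
    fun z hz => ⟨?_, hS.maximal_image_projectSubspace_restrictSpread hQ.nondegenerate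
      (by omega) hz, ?_⟩⟩
  · rw [show 4 * m * Module.finrank E F - 2 = Module.finrank E V - 2 by rw [hV']; ring_nf]
    exact isSymplecticSpace_quotientForm hQ'.nondegenerate (ne_zero_of_map hz)
  · rw [hS.1.restrictScalars.ncard_image_projectSubspace hQ'.nondegenerate (by nlinarith) hz,
      hcard]

open PartialSpread in
theorem mainTheorem4 {E : Type*} [Field E] [Finite E] (q k m : ℕ)
    (hq : Nat.card E = q) (hq_even : Even q) (hk : 1 ≤ k)
    (hm : ((k : ℝ) + 1) / 2 < (m : ℝ)) :
    -- every symplectic `E`-space of dimension `4mk - 2` has a maximal symplectic partial spread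
    -- of the stated size
    (∀ (W : Type*) [AddCommGroup W] [Module E W] (B : LinearMap.BilinForm E W),
      IsSymplecticSpace B (4 * m * k - 2) →
        ∃ T : Set (Submodule E W),
          Maximal (IsSymplecticPartialSpread B) T ∧ T.ncard = q ^ (2 * m * k - k) + 1) ∧
    -- such spreads arise by projection: `F` is the extension of `E` of degree `k` and `(V, Q)`
    -- is an orthogonal `F`-space of plus type and dimension `4m`
    (∀ (F V : Type*) [Field F] [Algebra E F] [AddCommGroup V] [Module F V] [Module E V]
      [IsScalarTower E F V] (Q : QuadraticForm F V),
      Module.finrank E F = k → IsOrthogonalPlusSpace Q (2 * m) →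
        (∃ S : Set (Submodule F V), IsOrthogonalSpread Q S) ∧
        IsOrthogonalPlusSpace (traceForm E Q) (2 * m * k) ∧
        ∀ S : Set (Submodule F V), IsOrthogonalSpread Q S →
          -- the orthogonal partial spread over `E`
          IsOrthogonalPartialSpread (traceForm E Q) (restrictSpread E S) ∧
          Maximal (IsPartialSpread E V) (restrictSpread E S) ∧
          (restrictSpread E S).ncard = q ^ (2 * m * k - k) + 1 ∧
          -- its projection from any nonsingular point
          ∀ z : V, traceForm E Q z ≠ 0 →
            IsSymplecticSpace (quotientForm (traceForm E Q) z) (4 * m * k - 2) ∧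
            Maximal (IsSymplecticPartialSpread (quotientForm (traceForm E Q) z))
              (projectSubspace (traceForm E Q) z '' restrictSpread E S) ∧
            (projectSubspace (traceForm E Q) z '' restrictSpread E S).ncard =
              q ^ (2 * m * k - k) + 1) := by
  have hm1 : (1 : ℝ) < m := by linarith [show (1 : ℝ) ≤ k by exact_mod_cast hk]
  exact mainTheorem4_general q k m hq hq_even hk (by exact_mod_cast hm1)
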